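/- Let $n,m,k$ be natural numbers and, for $i=1,2$, let $A_i\in\mathbb R^{n\times n}$, $B_i\in\mathbb R^{n\times m}$, $C_i\in\mathbb R^{k\times n}$, $G_i\in\mathbb R^{k\times m}$ define the linear system $$S_i:\quad x_i'(t)=A_ix_i(t)+B_iu(t),\qquad y_i(t)=C_ix_i(t)+G_iu(t).$$ Let $T>0$. The systems $S_1$ and $S_2$ are called distinguishable on $[0,T]$ if for every non-zero $(x_{10},x_{20},u)\in\mathbb R^n\times\mathbb R^n\times L^1(0,T;\mathbb R^m)$ the outputs $y_1$ and $y_2$, obtained from the common input $u$ and the initial states $x_1(0)=x_{10}$ and $x_2(0)=x_{20}$, are not identical on $[0,T]$. Here $x_i$ is the absolutely continuous solution of its differential equation (which holds almost everywhere), and outputs are identical if they agree almost everywhere. Put $$A=\begin{pmatrix}A_1&0\\0&A_2\end{pmatrix},\quad B=\begin{pmatrix}B_1\\B_2\end{pmatrix},\quad C=\begin{pmatrix}C_1&-C_2\end{pmatrix},\quad G=G_1-G_2 .$$ Then, for every $T>0$, $S_1$ and $S_2$ are distinguishable on $[0,T]$ if and only if for every $\lambda\in\mathbb C$ the complex matrix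 $$\mathcal M_\lambda=\begin{pmatrix}C&G\\ C(A-\lambda I)&CB\\ C(A-\lambda I)^2&C(A-\lambda I)B\\ \vdots&\vdots\\ C(A-\lambda I)^{2n}&C(A-\lambda I)^{2n-1}B\end{pmatrix}$$ has full column rank, that is, $\operatorname{rank}\mathcal M_\lambda=2n+m$. (For $n=0$ only the first block row is present.) -/

import Mathlib

open MeasureTheory

/-- A linear time-invariant system `x' = A x + B u`, `y = C x + G u` with state in `ℝⁿ`, input in
`ℝᵐ` and output in `ℝᵏ`. -/
structure LinearSystem (n m k : ℕ) where
  A : Matrix (Fin n) (Fin n) ℝ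
  B : Matrix (Fin n) (Fin m) ℝ
  C : Matrix (Fin k) (Fin n) ℝ
  G : Matrix (Fin k) (Fin m) ℝ

/-- The space `L¹(0, T; ℝᵐ)` of inputs (almost everywhere equal inputs are identified). -/
abbrev L1Input (T : ℝ) (m : ℕ) : Type :=
  Lp (Fin m → ℝ) 1 (volume.restrict (Set.Ioo (0 : ℝ) T))

namespace LinearSystem

variable {n m k : ℕ}

/-- `x` is the state trajectory on `[0, T]` with initial state `x₀` and input `u`, i.e. the
(Carathéodory) solution of `x' = A x + B u`, `x 0 = x₀`: it is absolutely continuous and satisfies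
the differential equation at almost every time. -/
structure IsTrajectory (S : LinearSystem n m k) (T : ℝ) (x₀ : Fin n → ℝ) (u : ℝ → Fin m → ℝ)
    (x : ℝ → Fin n → ℝ) : Prop where
  absolutelyContinuous : AbsolutelyContinuousOnInterval x 0 T
  initial : x 0 = x₀
  ode : ∀ᵐ t ∂(volume.restrict (Set.Ioo (0 : ℝ) T)),
    HasDerivAt x (S.A.mulVec (x t) + S.B.mulVec (u t)) t

/-- The output `y = C x + G u` produced by the state trajectory `x` and the input `u`. -/
def output (S : LinearSystem n m k) (u : ℝ → Fin m → ℝ) (x : ℝ → Fin n → ℝ) (t : ℝ) : Fin k → ℝ :=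
  S.C.mulVec (x t) + S.G.mulVec (u t)

/-- `S₁` and `S₂` are distinguishable on `[0, T]`: for every non-zero `(x₁₀, x₂₀, u)` in
`ℝⁿ × ℝⁿ × L¹(0, T; ℝᵐ)` the two outputs do not coincide. As `u`, hence the output, is only
defined up to null sets, coincidence means equality at almost every time. -/
def DistinguishableOn (S₁ S₂ : LinearSystem n m k) (T : ℝ) : Prop :=
  ∀ (x₁₀ x₂₀ : Fin n → ℝ) (u : L1Input T m), (x₁₀, x₂₀, u) ≠ 0 →
    ∀ x₁ x₂ : ℝ → Fin n → ℝ, S₁.IsTrajectory T x₁₀ u x₁ → S₂.IsTrajectory T x₂₀ u x₂ →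
      ¬ S₁.output u x₁ =ᵐ[volume.restrict (Set.Ioo (0 : ℝ) T)] S₂.output u x₂

/-- `A = diag(A₁, A₂)`. -/
def combinedA (S₁ S₂ : LinearSystem n m k) : Matrix (Fin n ⊕ Fin n) (Fin n ⊕ Fin n) ℝ :=
  Matrix.fromBlocks S₁.A 0 0 S₂.A

/-- `B = (B₁; B₂)`. -/
def combinedB (S₁ S₂ : LinearSystem n m k) : Matrix (Fin n ⊕ Fin n) (Fin m) ℝ :=
  Matrix.fromRows S₁.B S₂.B

/-- `C = (C₁, -C₂)`. -/
def combinedC (S₁ S₂ : LinearSystem n m k) : Matrix (Fin k) (Fin n ⊕ Fin n) ℝ :=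
  Matrix.fromCols S₁.C (-S₂.C)

/-- `G = G₁ - G₂`. -/
def combinedG (S₁ S₂ : LinearSystem n m k) : Matrix (Fin k) (Fin m) ℝ :=
  S₁.G - S₂.G

end LinearSystem

/-- Block row `j` of the stacked matrix: `[C, G]` for `j = 0`, and
`[C (A - λ I) ^ j, C (A - λ I) ^ (j - 1) B]` for `j ≥ 1`. -/
def blockRow {ι μ κ : Type*} [Fintype ι] [DecidableEq ι]
    (A : Matrix ι ι ℂ) (B : Matrix ι μ ℂ) (C : Matrix κ ι ℂ) (G : Matrix κ μ ℂ) (lam : ℂ) :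
    ℕ → Matrix κ (ι ⊕ μ) ℂ
  | 0 => Matrix.fromCols C G
  | j + 1 => Matrix.fromCols (C * (A - lam • (1 : Matrix ι ι ℂ)) ^ (j + 1))
      (C * (A - lam • (1 : Matrix ι ι ℂ)) ^ j * B)

namespace LinearSystem

variable {n m k : ℕ}

/-- The stacked matrix `M_λ` of the combined system, with block rows `0, 1, …, 2n`. -/
def stackedMatrix (S₁ S₂ : LinearSystem n m k) (lam : ℂ) :
    Matrix (Fin (2 * n + 1) × Fin k) ((Fin n ⊕ Fin n) ⊕ Fin m) ℂ :=
  Matrix.of fun r c =>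
    blockRow ((combinedA S₁ S₂).map Complex.ofReal) ((combinedB S₁ S₂).map Complex.ofReal)
      ((combinedC S₁ S₂).map Complex.ofReal) ((combinedG S₁ S₂).map Complex.ofReal)
      lam r.1 r.2 c

end LinearSystem

/-! With N = [[A - λ, B], [0, 0]], the block rows of the stacked matrix are (C G) N ^ j, and
Cayley–Hamilton shows that those with j ≤ 2n control all j
(`fromCols_mul_augmentedMatrix_pow_mulVec_eq_zero`). Necessity: if p is a kernel vector, then
exp(λt) exp(tN) p is a state-input pair solving the complexified system with zero output
(`exists_solution_output_eq_zero`). Its real and imaginary parts are real solutions, so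
distinguishability forces p = 0. Sufficiency: let V be the complex span of the states visited by a
zero-output trajectory. Derivatives of the trajectory stay in V, so each state of V has an input
that keeps A v + B w in V and the output zero. A linear feedback then makes V invariant, and if V ≠
0 an eigenvector yields a kernel vector for some λ (`exists_eigenvector_of_weakly_unobservable`).
Hence V = 0, and full rank at λ = 0 removes the input as well. -/

/-! ### Kernel of the stacked matrix -/

section StackedKernel

open Matrix

variable {ι μ κ : Type*} [Fintype ι] [DecidableEq ι] [Fintype μ] [DecidableEq μ]

/-- The matrix `[[A - λ, B], [0, 0]]` acting on pairs of a state and an input. -/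
def augmentedMatrix (A : Matrix ι ι ℂ) (B : Matrix ι μ ℂ) (lam : ℂ) :
    Matrix (ι ⊕ μ) (ι ⊕ μ) ℂ :=
  fromBlocks (A - lam • (1 : Matrix ι ι ℂ)) B 0 0

theorem blockRow_eq_mul_pow (A : Matrix ι ι ℂ) (B : Matrix ι μ ℂ) (C : Matrix κ ι ℂ)
    (G : Matrix κ μ ℂ) (lam : ℂ) (j : ℕ) :
    blockRow A B C G lam j = fromCols C G * augmentedMatrix A B lam ^ j := by
  have hpow : ∀ j : ℕ, augmentedMatrix A B lam ^ (j + 1) =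
      fromBlocks ((A - lam • (1 : Matrix ι ι ℂ)) ^ (j + 1))
        ((A - lam • (1 : Matrix ι ι ℂ)) ^ j * B) 0 0 := by
    intro j
    induction j with
    | zero => simp [augmentedMatrix]
    | succ j ih =>
      rw [pow_succ, ih, augmentedMatrix, fromBlocks_multiply]
      simp [pow_succ]
  cases j with
  | zero => simp [blockRow]
  | succ j =>
    rw [hpow, fromCols_mul_fromBlocks, blockRow]
    simp [Matrix.mul_assoc]

/-- By Cayley–Hamilton, `C M ^ j z = 0` for all `j` as soon as it holds for `j` below the size
of `M`. -/
theorem mul_pow_mulVec_eq_zero_of_lt_card (M : Matrix ι ι ℂ) (C : Matrix κ ι ℂ) (z : ι → ℂ)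
    (h : ∀ j < Fintype.card ι, (C * M ^ j) *ᵥ z = 0) (j : ℕ) : (C * M ^ j) *ᵥ z = 0 := by
  -- In size zero the characteristic polynomial is 1 and the strict degree bound on the remainder
  -- fails.
  rcases isEmpty_or_nonempty ι with hι | hι
  · have : z = 0 := Subsingleton.elim _ _
    simp [this]
  · have hdeg : (Polynomial.X ^ j %ₘ M.charpoly).natDegree < Fintype.card ι := by
      rw [← M.charpoly_natDegree_eq_dim]
      apply Polynomial.natDegree_modByMonic_lt _ M.charpoly_monic
      intro h1
      have := M.charpoly_natDegree_eq_dim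
      rw [h1, Polynomial.natDegree_one] at this
      exact Fintype.card_ne_zero this.symm
    rw [M.pow_eq_aeval_mod_charpoly j, Polynomial.aeval_eq_sum_range' hdeg, Matrix.mul_sum,
      Matrix.sum_mulVec]
    refine Finset.sum_eq_zero fun i hi => ?_
    rw [Matrix.mul_smul, Matrix.smul_mulVec, h i (Finset.mem_range.mp hi), smul_zero]

theorem fromCols_mul_augmentedMatrix_pow_mulVec_eq_zero (A : Matrix ι ι ℂ) (B : Matrix ι μ ℂ)
    (C : Matrix κ ι ℂ) (G : Matrix κ μ ℂ) (lam : ℂ) (p : ι ⊕ μ → ℂ)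
    (h : ∀ j < Fintype.card ι + 1, blockRow A B C G lam j *ᵥ p = 0) (j : ℕ) :
    (fromCols C G * augmentedMatrix A B lam ^ j) *ᵥ p = 0 := by
  rw [← blockRow_eq_mul_pow]
  cases j with
  | zero => exact h 0 (Nat.succ_pos _)
  | succ j =>
    -- All rows after the first see p = (v, w) only through (A - λ) v + B w, so Cayley–Hamilton is
    -- needed for A - λ alone, not for the larger augmented matrix.
    have key : ∀ j, blockRow A B C G lam (j + 1) *ᵥ p =
        (C * (A - lam • (1 : Matrix ι ι ℂ)) ^ j) *ᵥ
          ((A - lam • (1 : Matrix ι ι ℂ)) *ᵥ (p ∘ Sum.inl) + B *ᵥ (p ∘ Sum.inr)) := by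
      intro j
      rw [blockRow, fromCols_mulVec, mulVec_add, mulVec_mulVec, mulVec_mulVec, pow_succ,
        ← Matrix.mul_assoc]
    rw [key]
    refine mul_pow_mulVec_eq_zero_of_lt_card _ _ _ (fun i hi => ?_) j
    rw [← key]
    exact h (i + 1) (by omega)

/-- A zero direction of the Rosenbrock matrix is annihilated by every block row. -/
theorem blockRow_mulVec_eq_zero_of_eq_smul (A : Matrix ι ι ℂ) (B : Matrix ι μ ℂ)
    (C : Matrix κ ι ℂ) (G : Matrix κ μ ℂ) (lam : ℂ) (v : ι → ℂ) (w : μ → ℂ)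
    (h₁ : A *ᵥ v + B *ᵥ w = lam • v) (h₂ : C *ᵥ v + G *ᵥ w = 0) (j : ℕ) :
    blockRow A B C G lam j *ᵥ (Sum.elim v w) = 0 := by
  have hN : augmentedMatrix A B lam *ᵥ (Sum.elim v w) = 0 := by
    rw [augmentedMatrix, fromBlocks_mulVec]
    simp only [Sum.elim_comp_inl, Sum.elim_comp_inr, sub_mulVec, smul_mulVec, one_mulVec,
      zero_mulVec, add_zero]
    rw [sub_add_eq_add_sub, h₁, sub_self]
    ext i; cases i <;> rfl
  rw [blockRow_eq_mul_pow]
  cases j with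
  | zero => simpa [fromCols_mulVec] using h₂
  | succ j => rw [pow_succ, ← Matrix.mul_assoc, ← mulVec_mulVec, hN, mulVec_zero]

theorem rank_eq_card_iff_mulVec_eq_zero {ρ σ : Type*} [Fintype ρ] [Fintype σ]
    (M : Matrix ρ σ ℂ) :
    M.rank = Fintype.card σ ↔ ∀ p, M *ᵥ p = 0 → p = 0 := by
  have h := M.mulVecLin.finrank_range_add_finrank_ker
  rw [Module.finrank_fintype_fun_eq_card] at h
  have h2 : (∀ p, M *ᵥ p = 0 → p = 0) ↔ LinearMap.ker M.mulVecLin = ⊥ := by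
    rw [LinearMap.ker_eq_bot']; rfl
  rw [h2, ← Submodule.finrank_eq_zero, Matrix.rank]
  omega

theorem LinearSystem.stackedMatrix_rank_eq_iff {n m k : ℕ} (S₁ S₂ : LinearSystem n m k) (lam : ℂ) :
    (stackedMatrix S₁ S₂ lam).rank = 2 * n + m ↔
      ∀ p, (∀ j < 2 * n + 1, blockRow ((combinedA S₁ S₂).map Complex.ofReal)
        ((combinedB S₁ S₂).map Complex.ofReal) ((combinedC S₁ S₂).map Complex.ofReal)
        ((combinedG S₁ S₂).map Complex.ofReal) lam j *ᵥ p = 0) → p = 0 := by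
  have hc : Fintype.card ((Fin n ⊕ Fin n) ⊕ Fin m) = 2 * n + m := by simp [two_mul]
  rw [← hc, rank_eq_card_iff_mulVec_eq_zero]
  refine forall_congr' fun p => imp_congr_left ⟨fun h j hj => ?_, fun h => ?_⟩
  · ext r
    exact congrFun h (⟨j, hj⟩, r)
  · ext ⟨j, r⟩
    exact congrFun (h j j.2) r

end StackedKernel

/-! ### Feedback invariance and zero directions -/

section WeaklyUnobservable

open Matrix

variable {ι μ κ : Type*} [Fintype ι] [Fintype μ]

/-- If every `v ∈ V` admits an input `w` keeping `A v + B w` in `V` with zero output, and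
`V ≠ 0`, then the Rosenbrock matrix has a zero direction with nonzero state part. -/
theorem exists_eigenvector_of_weakly_unobservable (A : Matrix ι ι ℂ) (B : Matrix ι μ ℂ)
    (C : Matrix κ ι ℂ) (G : Matrix κ μ ℂ) (V : Submodule ℂ (ι → ℂ)) (hV : V ≠ ⊥)
    (h : ∀ v ∈ V, ∃ w, A *ᵥ v + B *ᵥ w ∈ V ∧ C *ᵥ v + G *ᵥ w = 0) :
    ∃ (lam : ℂ) (v : ι → ℂ) (w : μ → ℂ), v ≠ 0 ∧ A *ᵥ v + B *ᵥ w = lam • v ∧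
      C *ᵥ v + G *ᵥ w = 0 := by
  have : Nontrivial V := Submodule.nontrivial_iff_ne_bot.mpr hV
  let b := Module.finBasis ℂ V
  -- Choosing inputs only on a basis and extending linearly gives a linear feedback `F`; both
  -- conditions are linear, so they persist on V.
  choose w hw using fun i => h (b i) (b i).2
  let F : V →ₗ[ℂ] (μ → ℂ) := b.constr ℂ w
  have hF : ∀ i, F (b i) = w i := fun i => b.constr_basis ℂ w i
  let Φ : V →ₗ[ℂ] (ι → ℂ) := A.mulVecLin ∘ₗ V.subtype + B.mulVecLin ∘ₗ F
  let Ψ : V →ₗ[ℂ] (κ → ℂ) := C.mulVecLin ∘ₗ V.subtype + G.mulVecLin ∘ₗ F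
  have hΨ : Ψ = 0 := b.ext fun i => by simpa [Ψ, hF] using (hw i).2
  have hΦ : ∀ v, Φ v ∈ V := by
    have hb : V.mkQ ∘ₗ Φ = 0 := b.ext fun i => by
      simpa only [LinearMap.comp_apply, Submodule.mkQ_apply, LinearMap.zero_apply,
        Submodule.Quotient.mk_eq_zero, Φ, LinearMap.add_apply, Submodule.subtype_apply, hF,
        mulVecLin_apply]
        using (hw i).1
    intro v
    simpa using LinearMap.congr_fun hb v
  obtain ⟨lam, hlam⟩ := Module.End.exists_eigenvalue (Φ.codRestrict V hΦ)
  obtain ⟨v, hv⟩ := hlam.exists_hasEigenvector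
  refine ⟨lam, v, F v, by simpa using hv.2, ?_, ?_⟩
  · exact congrArg Subtype.val hv.apply_eq_smul
  · exact LinearMap.congr_fun hΨ v

end WeaklyUnobservable

/-! ### Zero-output solutions from kernel vectors -/

section ZeroOutputSolution

open Matrix

variable {ι μ κ : Type*} [Fintype ι] [DecidableEq ι] [Fintype μ] [DecidableEq μ]

/-- The exponential of an operator `L` maps `p` into the kernel of `K` if all `L ^ j p` lie
there. -/
theorem apply_exp_smul_apply_eq_zero {E F : Type*} [NormedAddCommGroup E] [NormedSpace ℂ E]
    [CompleteSpace E] [TopologicalSpace F] [T2Space F] [AddCommMonoid F] [Module ℂ F]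
    (K : E →L[ℂ] F) (L : E →L[ℂ] E) (p : E) (h : ∀ j : ℕ, K ((L ^ j) p) = 0) (t : ℂ) :
    K (NormedSpace.exp (t • L) p) = 0 := by
  have hs := NormedSpace.exp_series_hasSum_exp' (𝕂 := ℂ) (t • L)
  have hs' := (hs.mapL (ContinuousLinearMap.apply ℂ E p)).mapL K
  refine hs'.unique ?_
  convert hasSum_zero (α := F) (β := ℕ) using 2 with j
  simp only [smul_pow, ContinuousLinearMap.apply_apply, map_smul, h, smul_zero]

/-- A kernel vector `p` of the stacked matrix is the initial value of a solution
`(X t, U t)` of the complexified system with zero output. -/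
theorem exists_solution_output_eq_zero (A : Matrix ι ι ℂ) (B : Matrix ι μ ℂ)
    (C : Matrix κ ι ℂ) (G : Matrix κ μ ℂ) (lam : ℂ) (p : ι ⊕ μ → ℂ)
    (h : ∀ j < Fintype.card ι + 1, blockRow A B C G lam j *ᵥ p = 0) :
    ∃ (X : ℝ → ι → ℂ) (U : ℝ → μ → ℂ), Continuous U ∧ X 0 = p ∘ Sum.inl ∧ U 0 = p ∘ Sum.inr ∧
      (∀ t, HasDerivAt X (A *ᵥ X t + B *ᵥ U t) t) ∧ ∀ t, C *ᵥ X t + G *ᵥ U t = 0 := by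
  let N := augmentedMatrix A B lam
  let L : (ι ⊕ μ → ℂ) →L[ℂ] (ι ⊕ μ → ℂ) := N.mulVecLin.toContinuousLinearMap
  let K : (ι ⊕ μ → ℂ) →L[ℂ] (κ → ℂ) := (fromCols C G).mulVecLin.toContinuousLinearMap
  have hL : ∀ q, L q = N *ᵥ q := fun _ => rfl
  have hK : ∀ q, K q = fromCols C G *ᵥ q := fun _ => rfl
  have hLpow : ∀ j : ℕ, ∀ q, (L ^ j) q = (N ^ j) *ᵥ q := by
    intro j
    induction j with
    | zero => simp
    | succ j ih =>
      intro q
      rw [pow_succ, mul_apply_eq_comp, ih, hL, mulVec_mulVec, pow_succ]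
  let Y : ℂ → ι ⊕ μ → ℂ := fun t => NormedSpace.exp (t • L) p
  -- The factor exp(λt) undoes the shift by λ in the state equation; the input component becomes
  -- exp(λt) w.
  let Z : ℂ → ι ⊕ μ → ℂ := fun t => Complex.exp (t * lam) • Y t
  have hY : ∀ t, HasDerivAt Y (N *ᵥ Y t) t := fun t =>
    (hasDerivAt_exp_smul_const' (𝕂 := ℂ) L t).clm_apply (hasDerivAt_const t p) |>.congr_deriv
      (by simp [hL, Y])
  have hZ : ∀ t, HasDerivAt Z (lam • Z t + N *ᵥ Z t) t := fun t =>
    (((hasDerivAt_id t).mul_const lam).cexp.smul (hY t)).congr_deriv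
      (by simp [Z, mulVec_smul, smul_smul, mul_comm, add_comm])
  have hZ' : ∀ t : ℝ, HasDerivAt (fun s : ℝ => Z s) (lam • Z t + N *ᵥ Z t) t :=
    fun t => hasDerivAt_pi.mpr fun i => (hasDerivAt_pi.mp (hZ t) i).comp_ofReal
  have hY0 : Y 0 = p := by
    have h0 : NormedSpace.exp ((0 : ℂ) • L) = 1 := by rw [zero_smul ℂ L, NormedSpace.exp_zero]
    exact DFunLike.congr_fun h0 p
  have hZ0 : Z 0 = p := by simp [Z, hY0]
  have hZc : Continuous fun s : ℝ => Z s :=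
    continuous_iff_continuousAt.mpr fun t => (hZ' t).continuousAt
  refine ⟨fun t => Z t ∘ Sum.inl, fun t => Z t ∘ Sum.inr, ?_, ?_, ?_, fun t => ?_, fun t => ?_⟩
  · exact continuous_pi fun i => (continuous_apply (Sum.inr i)).comp hZc
  · simp [hZ0]
  · simp [hZ0]
  · have h1 : lam • Z t + N *ᵥ Z t = Sum.elim (A *ᵥ (Z t ∘ Sum.inl) + B *ᵥ (Z t ∘ Sum.inr))
        (lam • (Z t ∘ Sum.inr)) := by
      simp only [N, augmentedMatrix, fromBlocks_mulVec, sub_mulVec, smul_mulVec, one_mulVec,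
        zero_mulVec, add_zero]
      ext i
      cases i <;> simp
      ring
    have h2 := hZ' t
    rw [h1, hasDerivAt_pi] at h2
    exact hasDerivAt_pi.mpr fun i => h2 (Sum.inl i)
  · have h1 : K (Y t) = 0 := apply_exp_smul_apply_eq_zero K L p (fun j => by
      rw [hLpow, hK, mulVec_mulVec]
      exact fromCols_mul_augmentedMatrix_pow_mulVec_eq_zero A B C G lam p h j) t
    have h2 : K (Z t) = 0 := by rw [map_smul, h1, smul_zero]
    rwa [hK, fromCols_mulVec] at h2

end ZeroOutputSolution

/-! ### Real trajectories and the two implications -/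

section Trajectory

open Matrix Set

/-- A function with an everywhere defined continuous derivative is absolutely continuous on
bounded intervals. -/
theorem absolutelyContinuousOnInterval_of_hasDerivAt {E : Type*} [NormedAddCommGroup E]
    [NormedSpace ℝ E] {f f' : ℝ → E} (hf : ∀ t, HasDerivAt f (f' t) t) (hc : Continuous f')
    (a b : ℝ) : AbsolutelyContinuousOnInterval f a b := by
  obtain ⟨K, hK⟩ := (isCompact_uIcc (a := a) (b := b)).exists_bound_of_continuousOn hc.continuousOn
  refine LipschitzOnWith.absolutelyContinuousOnInterval (K := K.toNNReal) ?_
  refine (convex_uIcc a b).lipschitzOnWith_of_nnnorm_hasDerivWithin_le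
    (fun t _ => (hf t).hasDerivWithinAt) fun t ht => ?_
  rw [← NNReal.coe_le_coe, coe_nnnorm]
  exact (hK t ht).trans (Real.le_coe_toNNReal K)

/-- A continuous function lying in a closed set at almost every time lies in it at all times. -/
theorem mem_of_ae_mem_of_continuousOn {E : Type*} [TopologicalSpace E] {f : ℝ → E} {T : ℝ}
    (hT : 0 < T) (hf : ContinuousOn f (Icc 0 T)) {F : Set E} (hF : IsClosed F)
    (h : ∀ᵐ t ∂(volume.restrict (Ioo (0 : ℝ) T)), f t ∈ F) : ∀ t ∈ Icc 0 T, f t ∈ F := by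
  have hmaps : MapsTo f (Ioo 0 T) F := by
    by_contra hcon
    obtain ⟨t, ht, htF⟩ : ∃ t ∈ Ioo 0 T, f t ∉ F := by simpa [MapsTo, and_assoc] using hcon
    have hopen : IsOpen (Ioo 0 T ∩ f ⁻¹' Fᶜ) :=
      (hf.mono Ioo_subset_Icc_self).isOpen_inter_preimage isOpen_Ioo hF.isOpen_compl
    have hpos := hopen.measure_pos volume ⟨t, ht, htF⟩
    rw [ae_iff, Measure.restrict_apply₀' measurableSet_Ioo.nullMeasurableSet] at h
    refine hpos.ne' ?_
    rw [inter_comm]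
    exact h
  have hcl := hmaps.closure_of_continuousOn (by rwa [closure_Ioo hT.ne])
  rw [closure_Ioo hT.ne, hF.closure_eq] at hcl
  exact hcl

/-- Difference quotients of `f` lie in V, and V is closed. -/
theorem HasDerivAt.mem_submodule {E : Type*} [NormedAddCommGroup E] [NormedSpace ℝ E]
    {f : ℝ → E} {f' : E} {t : ℝ} (h : HasDerivAt f f' t) (V : Submodule ℝ E)
    (hV : IsClosed (V : Set E)) (hf : ∀ᶠ s in nhds t, f s ∈ V) : f' ∈ V := by
  refine hV.mem_of_tendsto h.tendsto_slope (Filter.Eventually.filter_mono nhdsWithin_le_nhds ?_)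
  filter_upwards [hf] with s hs
  exact V.smul_mem _ (V.sub_mem hs hf.self_of_nhds)

theorem map_ofReal_mulVec_comp {ρ σ : Type*} [Fintype σ] (φ : ℂ →ₗ[ℝ] ℝ) (M : Matrix ρ σ ℝ)
    (z : σ → ℂ) : φ ∘ (M.map Complex.ofReal *ᵥ z) = M *ᵥ (φ ∘ z) := by
  ext i
  simp only [Function.comp_apply, mulVec, dotProduct, map_sum, map_apply]
  refine Finset.sum_congr rfl fun j _ => ?_
  rw [← Complex.real_smul, map_smul, smul_eq_mul]

theorem ofReal_comp_mulVec {ρ σ : Type*} [Fintype σ] (M : Matrix ρ σ ℝ) (z : σ → ℝ) :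
    Complex.ofReal ∘ (M *ᵥ z) = M.map Complex.ofReal *ᵥ (Complex.ofReal ∘ z) := by
  ext i
  simp [mulVec, dotProduct]

namespace LinearSystem

variable {n m k : ℕ}

theorem combinedA_mulVec (S₁ S₂ : LinearSystem n m k) (x₁ x₂ : Fin n → ℝ) :
    combinedA S₁ S₂ *ᵥ Sum.elim x₁ x₂ = Sum.elim (S₁.A *ᵥ x₁) (S₂.A *ᵥ x₂) := by
  simp [combinedA, fromBlocks_mulVec]

theorem combinedB_mulVec (S₁ S₂ : LinearSystem n m k) (u : Fin m → ℝ) :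
    combinedB S₁ S₂ *ᵥ u = Sum.elim (S₁.B *ᵥ u) (S₂.B *ᵥ u) := by
  simp [combinedB, fromRows_mulVec]

theorem combined_output (S₁ S₂ : LinearSystem n m k) (x₁ x₂ : Fin n → ℝ) (u : Fin m → ℝ) :
    combinedC S₁ S₂ *ᵥ Sum.elim x₁ x₂ + combinedG S₁ S₂ *ᵥ u =
      (S₁.C *ᵥ x₁ + S₁.G *ᵥ u) - (S₂.C *ᵥ x₂ + S₂.G *ᵥ u) := by
  rw [combinedC, combinedG, fromCols_mulVec, sub_mulVec, neg_mulVec]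
  simp only [Sum.elim_comp_inl, Sum.elim_comp_inr]
  abel

/-- For distinguishable systems, a real solution of the combined system with
continuous input and zero output starts from zero state and zero input. -/
theorem DistinguishableOn.eq_zero_of_solution {S₁ S₂ : LinearSystem n m k} {T : ℝ} (hT : 0 < T)
    (h : DistinguishableOn S₁ S₂ T) {x : ℝ → Fin n ⊕ Fin n → ℝ} {u : ℝ → Fin m → ℝ}
    (hu : Continuous u)
    (hx : ∀ t, HasDerivAt x (combinedA S₁ S₂ *ᵥ x t + combinedB S₁ S₂ *ᵥ u t) t)
    (hy : ∀ t, combinedC S₁ S₂ *ᵥ x t + combinedG S₁ S₂ *ᵥ u t = 0) :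
    x 0 = 0 ∧ u 0 = 0 := by
  have hmem : MemLp u 1 (volume.restrict (Ioo (0 : ℝ) T)) := by
    rw [memLp_one_iff_integrable]
    exact (hu.integrableOn_Icc (a := 0) (b := T)).mono_set Ioo_subset_Icc_self
  have hxc : Continuous x := continuous_iff_continuousAt.mpr fun t => (hx t).continuousAt
  let x₁ : ℝ → Fin n → ℝ := fun t => x t ∘ Sum.inl
  let x₂ : ℝ → Fin n → ℝ := fun t => x t ∘ Sum.inr
  have hx_elim : ∀ t, x t = Sum.elim (x₁ t) (x₂ t) := fun t => (Sum.elim_comp_inl_inr _).symm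
  have hx₁c : Continuous x₁ := continuous_pi fun i => (continuous_apply (Sum.inl i)).comp hxc
  have hx₂c : Continuous x₂ := continuous_pi fun i => (continuous_apply (Sum.inr i)).comp hxc
  have hd : ∀ t, HasDerivAt x₁ (S₁.A *ᵥ x₁ t + S₁.B *ᵥ u t) t ∧
      HasDerivAt x₂ (S₂.A *ᵥ x₂ t + S₂.B *ᵥ u t) t := by
    intro t
    have := hx t
    rw [hx_elim t, combinedA_mulVec, combinedB_mulVec, hasDerivAt_pi] at this
    exact ⟨hasDerivAt_pi.mpr fun i => this (Sum.inl i), hasDerivAt_pi.mpr fun i => this (Sum.inr i)⟩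
  have hae := hmem.coeFn_toLp
  have htraj : ∀ (S : LinearSystem n m k) (z : ℝ → Fin n → ℝ), Continuous z →
      (∀ t, HasDerivAt z (S.A *ᵥ z t + S.B *ᵥ u t) t) →
      S.IsTrajectory T (z 0) (hmem.toLp u) z := fun S z hz hdz =>
    { absolutelyContinuous := absolutelyContinuousOnInterval_of_hasDerivAt hdz
        ((continuous_const.matrix_mulVec hz).add (continuous_const.matrix_mulVec hu)) 0 T
      initial := rfl
      ode := by
        filter_upwards [hae] with t ht
        rw [ht]
        exact hdz t }
  have hzero : (x₁ 0, x₂ 0, hmem.toLp u) = (0 : (Fin n → ℝ) × (Fin n → ℝ) × L1Input T m) := by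
    by_contra hne
    refine h _ _ _ hne x₁ x₂ (htraj S₁ x₁ hx₁c fun t => (hd t).1)
      (htraj S₂ x₂ hx₂c fun t => (hd t).2) ?_
    filter_upwards [hae] with t ht
    have := hy t
    rw [hx_elim t, combined_output, sub_eq_zero] at this
    rw [output, output, ht]
    exact this
  simp only [Prod.mk_eq_zero] at hzero
  obtain ⟨h₁, h₂, h₃⟩ := hzero
  refine ⟨?_, ?_⟩
  · rw [hx_elim, h₁, h₂]
    ext i; cases i <;> rfl
  · refine mem_of_ae_mem_of_continuousOn hT hu.continuousOn isClosed_singleton (F := {0}) ?_ 0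
      ⟨le_rfl, hT.le⟩
    have := Lp.coeFn_zero (Fin m → ℝ) 1 (volume.restrict (Ioo (0 : ℝ) T))
    rw [← h₃] at this
    filter_upwards [hae, this] with t ht ht'
    rw [mem_singleton_iff, ← ht, ht']
    rfl

theorem DistinguishableOn.rank_stackedMatrix {S₁ S₂ : LinearSystem n m k} {T : ℝ} (hT : 0 < T)
    (h : DistinguishableOn S₁ S₂ T) (lam : ℂ) : (stackedMatrix S₁ S₂ lam).rank = 2 * n + m := by
  rw [stackedMatrix_rank_eq_iff]
  intro p hp
  obtain ⟨X, U, hU, hX0, hU0, hX, hY⟩ := exists_solution_output_eq_zero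
    ((combinedA S₁ S₂).map Complex.ofReal) ((combinedB S₁ S₂).map Complex.ofReal)
    ((combinedC S₁ S₂).map Complex.ofReal) ((combinedG S₁ S₂).map Complex.ofReal) lam p
    (by simpa [two_mul] using hp)
  -- The system matrices are real, so any real functional, in particular Re or Im, turns the complex
  -- solution into a real one.
  have key : ∀ φ : ℂ →L[ℝ] ℝ, φ ∘ p = 0 := by
    intro φ
    have hadd : ∀ {σ : Type} (a b : σ → ℂ), φ ∘ (a + b) = φ ∘ a + φ ∘ b := fun a b => by
      ext; simp
    obtain ⟨h1, h2⟩ := h.eq_zero_of_solution hT (x := fun t => φ ∘ X t) (u := fun t => φ ∘ U t)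
      (continuous_pi fun i => φ.continuous.comp ((continuous_apply i).comp hU))
      (fun t => by
        have hm := map_ofReal_mulVec_comp φ.toLinearMap (combinedA S₁ S₂) (X t)
        have hm' := map_ofReal_mulVec_comp φ.toLinearMap (combinedB S₁ S₂) (U t)
        simp only [ContinuousLinearMap.coe_coe] at hm hm'
        rw [← hm, ← hm', ← hadd]
        exact hasDerivAt_pi.mpr fun i =>
          φ.hasFDerivAt.comp_hasDerivAt t (hasDerivAt_pi.mp (hX t) i))
      (fun t => by
        have hm := map_ofReal_mulVec_comp φ.toLinearMap (combinedC S₁ S₂) (X t)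
        have hm' := map_ofReal_mulVec_comp φ.toLinearMap (combinedG S₁ S₂) (U t)
        simp only [ContinuousLinearMap.coe_coe] at hm hm'
        rw [← hm, ← hm', ← hadd, hY t]
        ext; simp)
    rw [hX0] at h1
    rw [hU0] at h2
    ext (i | i)
    · exact congrFun h1 i
    · exact congrFun h2 i
  ext i
  exact Complex.ext (congrFun (key Complex.reCLM) i) (congrFun (key Complex.imCLM) i)

theorem distinguishableOn_of_rank_stackedMatrix {S₁ S₂ : LinearSystem n m k} {T : ℝ} (hT : 0 < T)
    (h : ∀ lam : ℂ, (stackedMatrix S₁ S₂ lam).rank = 2 * n + m) : DistinguishableOn S₁ S₂ T := by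
  intro x₁₀ x₂₀ u hne x₁ x₂ hx₁ hx₂ hout
  apply hne
  simp only [stackedMatrix_rank_eq_iff] at h
  set A := (combinedA S₁ S₂).map Complex.ofReal
  set B := (combinedB S₁ S₂).map Complex.ofReal
  set C := (combinedC S₁ S₂).map Complex.ofReal
  set G := (combinedG S₁ S₂).map Complex.ofReal
  have hzero : ∀ (lam : ℂ) (v : Fin n ⊕ Fin n → ℂ) (w : Fin m → ℂ), A *ᵥ v + B *ᵥ w = lam • v →
      C *ᵥ v + G *ᵥ w = 0 → v = 0 ∧ w = 0 := by
    intro lam v w h₁ h₂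
    have hp := h lam (Sum.elim v w) fun j _ =>
      blockRow_mulVec_eq_zero_of_eq_smul A B C G lam v w h₁ h₂ j
    exact ⟨funext fun i => congrFun hp (Sum.inl i), funext fun i => congrFun hp (Sum.inr i)⟩
  let X : ℝ → Fin n ⊕ Fin n → ℂ := fun t => Complex.ofReal ∘ Sum.elim (x₁ t) (x₂ t)
  let U : ℝ → Fin m → ℂ := fun t => Complex.ofReal ∘ u t
  have hadd : ∀ {σ : Type} (a b : σ → ℝ),
      Complex.ofReal ∘ (a + b) = Complex.ofReal ∘ a + Complex.ofReal ∘ b := fun a b => by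
    ext; simp
  have hXc : ContinuousOn X (Icc 0 T) := by
    have h₁ := hx₁.absolutelyContinuous.continuousOn
    have h₂ := hx₂.absolutelyContinuous.continuousOn
    rw [uIcc_of_le hT.le, continuousOn_pi] at h₁ h₂
    refine continuousOn_pi.mpr fun i => Complex.continuous_ofReal.comp_continuousOn ?_
    cases i with
    | inl i => exact h₁ i
    | inr i => exact h₂ i
  have hode : ∀ᵐ t ∂(volume.restrict (Ioo (0 : ℝ) T)),
      HasDerivAt X (A *ᵥ X t + B *ᵥ U t) t := by
    filter_upwards [hx₁.ode, hx₂.ode] with t h₁ h₂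
    rw [hasDerivAt_pi] at h₁ h₂
    simp only [X, U, A, B]
    rw [← ofReal_comp_mulVec, ← ofReal_comp_mulVec, ← hadd, combinedA_mulVec, combinedB_mulVec]
    refine hasDerivAt_pi.mpr fun i => ?_
    cases i with
    | inl i => exact (h₁ i).ofReal_comp
    | inr i => exact (h₂ i).ofReal_comp
  have hzout : ∀ᵐ t ∂(volume.restrict (Ioo (0 : ℝ) T)), C *ᵥ X t + G *ᵥ U t = 0 := by
    filter_upwards [hout] with t ht
    rw [output, output, ← sub_eq_zero] at ht
    simp only [X, U, C, G]
    rw [← ofReal_comp_mulVec, ← ofReal_comp_mulVec, ← hadd, combined_output, ht]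
    ext; simp
  let V : Submodule ℂ (Fin n ⊕ Fin n → ℂ) := Submodule.span ℂ (X '' Icc 0 T)
  have hXV : ∀ t ∈ Icc 0 T, X t ∈ V := fun t ht => Submodule.subset_span ⟨t, ht, rfl⟩
  let P : Submodule ℂ ((Fin n ⊕ Fin n → ℂ) × (Fin m → ℂ)) :=
    V.comap (A.mulVecLin.coprod B.mulVecLin) ⊓ LinearMap.ker (C.mulVecLin.coprod G.mulVecLin)
  -- `W` is the set of states admitting an input with A v + B w in V and zero output. Being a closed
  -- subspace, it captures every X t from almost every one, and hence all of V.
  let W := P.map (LinearMap.fst ℂ _ _)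
  have hXW : ∀ t ∈ Icc 0 T, X t ∈ W := by
    refine mem_of_ae_mem_of_continuousOn hT hXc (F := (W : Set _)) W.closed_of_finiteDimensional ?_
    filter_upwards [hode, hzout, ae_restrict_mem measurableSet_Ioo] with t h₁ h₂ ht
    refine ⟨(X t, U t), ⟨?_, h₂⟩, rfl⟩
    refine h₁.mem_submodule (V.restrictScalars ℝ) V.closed_of_finiteDimensional ?_
    filter_upwards [Ioo_mem_nhds ht.1 ht.2] with s hs
    exact hXV s (Ioo_subset_Icc_self hs)
  have hVW : V ≤ W := Submodule.span_le.mpr (by rintro _ ⟨t, ht, rfl⟩; exact hXW t ht)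
  have hV : V = ⊥ := by
    by_contra hV
    obtain ⟨lam, v, w, hv, h₁, h₂⟩ := exists_eigenvector_of_weakly_unobservable A B C G V hV
      (fun v hv => by
        obtain ⟨⟨v', w⟩, ⟨h₁, h₂⟩, rfl⟩ := hVW hv
        exact ⟨w, h₁, h₂⟩)
    exact hv (hzero lam v w h₁ h₂).1
  have hX0 : ∀ t ∈ Icc 0 T, X t = 0 := fun t ht => by simpa [hV] using hXV t ht
  have h0 : ∀ i, Sum.elim (x₁ 0) (x₂ 0) i = 0 := fun i => by
    simpa [X] using congrFun (hX0 0 ⟨le_rfl, hT.le⟩) i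
  have hu : u = 0 := by
    rw [Lp.eq_zero_iff_ae_eq_zero]
    filter_upwards [hode, hzout, ae_restrict_mem measurableSet_Ioo] with t h₁ h₂ ht
    have hd : A *ᵥ X t + B *ᵥ U t = 0 := by
      refine h₁.unique ((hasDerivAt_const t 0).congr_of_eventuallyEq ?_)
      filter_upwards [Ioo_mem_nhds ht.1 ht.2] with s hs
      exact hX0 s (Ioo_subset_Icc_self hs)
    -- Since X vanishes, B U = 0 and G U = 0, so (0, U t) is a zero direction; λ = 0 is an arbitrary
    -- choice.
    have hU := (hzero 0 (X t) (U t) (by rw [hd, zero_smul]) h₂).2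
    ext i
    simpa [U] using congrFun hU i
  rw [← hx₁.initial, ← hx₂.initial, hu]
  exact Prod.ext (funext fun i => h0 (Sum.inl i))
    (Prod.ext (funext fun i => h0 (Sum.inr i)) rfl)

end LinearSystem

end Trajectory

theorem theorem3p4 {n m k : ℕ} (S₁ S₂ : LinearSystem n m k) (T : ℝ) (hT : 0 < T) :
    LinearSystem.DistinguishableOn S₁ S₂ T ↔
      ∀ lam : ℂ, (LinearSystem.stackedMatrix S₁ S₂ lam).rank = 2 * n + m :=
  ⟨fun h lam => h.rank_stackedMatrix hT lam,
    LinearSystem.distinguishableOn_of_rank_stackedMatrix hT⟩
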